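/- Datasets are finite sequences $S=(X_1,\dots,X_n)$ of points of a set $\mathcal X$, and $S^{-i}$ is $S$ with $X_i$ removed. A randomized algorithm $M$ is $(\epsilon,\delta)$-DP if $\Pr[M(S)\in E]\le e^{\epsilon}\Pr[M(S')\in E]+\delta$, and $B$-zCDP if $D_\alpha(M(S)\|M(S'))\le B\alpha$ for all $\alpha>1$, where $D_\alpha$ is the Rényi divergence of order $\alpha$; in both cases for all pairs $(S,S')$ of the form $(S,S^{-i})$ or $(S^{-i},S)$, and for all measurable $E$. Let $\mathcal A_t(a_1,\dots,a_{t-1},S)$, $t=1,2,\dots$, be adaptive randomized algorithms (Markov kernels in the past reports $a_1,\dots,a_{t-1}$), and let $\mathcal S$ be a symmetric set of pairs of datasets (for instance, all pairs $(S,S^{-i})$, $(S^{-i},S)$). The pure privacy parameter of round $t$ given the past reports is $$\epsilon_t=\epsilon_t(a_1,\dots,a_{t-1})=\sup_{(S,S')\in\mathcal S}\ \sup_{E}\ \log\frac{\Pr[\mathcal A_t(a_1,\dots,a_{t-1},S)\in E]}{\Pr[\mathcal A_t(a_1,\dots,a_{t-1},S')\in E]}\in[0,\infty].$$ Given a filter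 $\mathcal G$, a map from finite sequences in $[0,\infty]$ to $\{\mathrm{CONT},\mathrm{HALT}\}$, and a maximal number $N$ of rounds, adaptive composition with the filter $\mathcal G$ starts with $k=0$ and, as long as $k<N$ and $\mathcal G(\epsilon_1,\dots,\epsilon_{k+1})=\mathrm{CONT}$, increases $k$ by one and computes $a_k=\mathcal A_k(a_1,\dots,a_{k-1},S)$; its output $\mathcal A^{(k)}(S)=(a_1,\dots,a_k)$ is the sequence of reports, of random length, made before it stops. The filter $\mathcal G$ is a valid $(\epsilon_g,\delta_g)$-DP filter if for all $\mathcal X$, $\mathcal S$, $N$ and all algorithms $\mathcal A_t$ (for which the decisions to continue are measurable events), this output satisfies $$\Pr[\mathcal A^{(k)}(S)\in E]\le e^{\epsilon_g}\Pr[\mathcal A^{(k)}(S')\in E]+\delta_g$$ for all $(S,S')\in\mathcal S$ and all measurable $E$. Theorem. Let $\epsilon_g\ge 0$ and $\delta_g\in(0,1)$. There is a largest $B>0$ such that every $B$-zCDP algorithm is $(\epsilon_g,\delta_g)$-DP; call it $B^\star$. The filter $$\mathcal G(\epsilon_1,\dots,\epsilon_k)=\begin{cases}\mathrm{CONT},&\text{if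 }\tfrac12\sum_{t=1}^k\epsilon_t^2\le B^\star,\\ \mathrm{HALT},&\text{if }\tfrac12\sum_{t=1}^k\epsilon_t^2> B^\star,\end{cases}$$ is a valid $(\epsilon_g,\delta_g)$-DP filter. Moreover, for the explicit level $B_0=\left(\sqrt{\log(1/\delta_g)+\epsilon_g}-\sqrt{\log(1/\delta_g)}\right)^2$, every $B_0$-zCDP algorithm is $(\epsilon_g,\delta_g)$-DP, and the filter with $B_0$ in place of $B^\star$ is also a valid $(\epsilon_g,\delta_g)$-DP filter. -/

import Mathlib

open MeasureTheory ProbabilityTheory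
open scoped ENNReal

universe u v

noncomputable section

namespace DPFilter

/-! ### Divergences between output distributions -/

/-- The Rényi divergence of order `α > 1`, equal to `+∞` when `μ` is not absolutely continuous
with respect to `ν`. -/
def renyiDiv {Ω : Type*} [MeasurableSpace Ω] (α : ℝ) (μ ν : Measure Ω) : EReal :=
  open Classical in
  if μ ≪ ν then
    (((α - 1)⁻¹ : ℝ) : EReal) * ENNReal.log (∫⁻ x, (μ.rnDeriv ν x) ^ α ∂ν)
  else ⊤

/-- `sup_E log (μ E / ν E)` over all measurable events `E`. In `ℝ≥0∞` one has `c / 0 = ∞` for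
`c ≠ 0`, and `0 / 0 = 0`, so that events that are null for both measures do not contribute. -/
def logRatioSup {Ω : Type*} [MeasurableSpace Ω] (μ ν : Measure Ω) : EReal :=
  ⨆ (E : Set Ω) (_ : MeasurableSet E), ENNReal.log (μ E / ν E)

/-! ### Privacy of a randomized algorithm

A dataset is a finite sequence `S : List 𝒳`, and a randomized algorithm is the map that sends a
dataset to the law of the output. Privacy is measured over a set `𝒮` of pairs of datasets;
the usual choice of `𝒮` is `removalPairs 𝒳`. -/

/-- All pairs `(S, S⁻ⁱ)` and `(S⁻ⁱ, S)`, where `S⁻ⁱ` is `S` without its `i`-th entry. -/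
def removalPairs (𝒳 : Type u) : Set (List 𝒳 × List 𝒳) :=
  {p | ∃ (S : List 𝒳) (i : Fin S.length), p = (S, S.eraseIdx i) ∨ p = (S.eraseIdx i, S)}

/-- `𝒮` contains `(S', S)` whenever it contains `(S, S')`. -/
def IsSymmetric {𝒳 : Type u} (𝒮 : Set (List 𝒳 × List 𝒳)) : Prop :=
  ∀ S S', (S, S') ∈ 𝒮 → (S', S) ∈ 𝒮

/-- `(ε, δ)`-differential privacy. -/
def IsDP {𝒳 : Type u} {Ω : Type v} [MeasurableSpace Ω] (𝒮 : Set (List 𝒳 × List 𝒳))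
    (ε δ : ℝ) (M : List 𝒳 → Measure Ω) : Prop :=
  ∀ S S', (S, S') ∈ 𝒮 → ∀ E : Set Ω, MeasurableSet E →
    (M S).real E ≤ Real.exp ε * (M S').real E + δ

/-- `B`-zero-concentrated differential privacy. -/
def IsZCDP {𝒳 : Type u} {Ω : Type v} [MeasurableSpace Ω] (𝒮 : Set (List 𝒳 × List 𝒳))
    (B : ℝ) (M : List 𝒳 → Measure Ω) : Prop :=
  ∀ S S', (S, S') ∈ 𝒮 → ∀ α : ℝ, 1 < α → renyiDiv α (M S) (M S') ≤ ((B * α : ℝ) : EReal)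

/-- `B`-zCDP implies `(ε, δ)`-DP: every randomized algorithm with the former property has the
latter. -/
def ZCDPImpliesDP (B ε δ : ℝ) : Prop :=
  ∀ (𝒳 : Type u) (Ω : Type v) [MeasurableSpace Ω] (M : List 𝒳 → Measure Ω)
    [∀ S, IsProbabilityMeasure (M S)],
    IsZCDP (removalPairs 𝒳) B M → IsDP (removalPairs 𝒳) ε δ M

/-! ### Adaptive composition

Rounds are numbered from `0`; the report of round `t` lives in the measurable space `𝒴 t`. -/

/-- The space of the first `k` reports, `𝒴 0 × ⋯ × 𝒴 (k - 1)`. -/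
def Hist (𝒴 : ℕ → Type v) : ℕ → Type v
  | 0 => PUnit
  | k + 1 => Hist 𝒴 k × 𝒴 k

/-- The product σ-algebra. -/
instance Hist.instMeasurableSpace (𝒴 : ℕ → Type v) [∀ t, MeasurableSpace (𝒴 t)] :
    ∀ k, MeasurableSpace (Hist 𝒴 k)
  | 0 => inferInstanceAs (MeasurableSpace PUnit)
  | k + 1 =>
    letI := Hist.instMeasurableSpace 𝒴 k
    inferInstanceAs (MeasurableSpace (Hist 𝒴 k × 𝒴 k))

/-- Append the report of round `k` to the earlier reports. -/
def Hist.snoc {𝒴 : ℕ → Type v} {k : ℕ} (h : Hist 𝒴 k) (a : 𝒴 k) : Hist 𝒴 (k + 1) := (h, a)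

/-- A finite sequence of reports, of any length. -/
abbrev Transcript (𝒴 : ℕ → Type v) : Type v := Σ k, Hist 𝒴 k

/-- A sequence of adaptive algorithms: `A t S h` is the law of the report of round `t` on the
dataset `S` when the earlier reports are `h`. -/
abbrev AlgSeq (𝒳 : Type u) (𝒴 : ℕ → Type v) [∀ t, MeasurableSpace (𝒴 t)] :=
  (t : ℕ) → List 𝒳 → Kernel (Hist 𝒴 t) (𝒴 t)

section Composition

variable {𝒳 : Type u} {𝒴 : ℕ → Type v} [∀ t, MeasurableSpace (𝒴 t)]

/-- The pure DP parameter of round `t` given the earlier reports `h`, that is,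
`sup_{(S, S') ∈ 𝒮} sup_E log (Pr[A_t(h, S) ∈ E] / Pr[A_t(h, S') ∈ E])`. The supremum is `≥ 0` for
Markov kernels (take `E` to be the whole space), and it is `∞` if `A_t(h, ·)` is not `ε`-DP for any
real `ε`; an empty `𝒮` gives `0`. -/
def epsParam (𝒮 : Set (List 𝒳 × List 𝒳)) (A : AlgSeq 𝒳 𝒴) (t : ℕ) (h : Hist 𝒴 t) : ℝ≥0∞ :=
  (⨆ p ∈ 𝒮, logRatioSup (A t p.1 h) (A t p.2 h)).toENNReal

/-- The parameters of the rounds `0, …, k`, given the first `k` reports. -/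
def epsList (𝒮 : Set (List 𝒳 × List 𝒳)) (A : AlgSeq 𝒳 𝒴) : (k : ℕ) → Hist 𝒴 k → List ℝ≥0∞
  | 0, h => [epsParam 𝒮 A 0 h]
  | k + 1, h => epsList 𝒮 A k h.1 ++ [epsParam 𝒮 A (k + 1) h]

end Composition

/-! ### Filters -/

/-- The possible answers of a filter. -/
inductive Answer : Type
  | CONT
  | HALT

section Filter

variable {𝒳 : Type u} {𝒴 : ℕ → Type v} [∀ t, MeasurableSpace (𝒴 t)]

/-- The law of the output of adaptive composition on `S` with the filter `G`, when the reports `h`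
of the first `k` rounds have been made and at most `m` further rounds are allowed. -/
def runFrom (G : List ℝ≥0∞ → Answer) (𝒮 : Set (List 𝒳 × List 𝒳)) (A : AlgSeq 𝒳 𝒴)
    (S : List 𝒳) : (m k : ℕ) → Hist 𝒴 k → Measure (Transcript 𝒴)
  | 0, k, h => Measure.dirac ⟨k, h⟩
  | m + 1, k, h =>
    match G (epsList 𝒮 A k h) with
    | Answer.CONT => (A k S h).bind fun a => runFrom G 𝒮 A S m (k + 1) (h.snoc a)
    | Answer.HALT => Measure.dirac ⟨k, h⟩

/-- Adaptive composition with the filter `G` and at most `N` rounds. -/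
def filteredComposition (G : List ℝ≥0∞ → Answer) (𝒮 : Set (List 𝒳 × List 𝒳))
    (A : AlgSeq 𝒳 𝒴) (N : ℕ) (S : List 𝒳) : Measure (Transcript 𝒴) :=
  runFrom G 𝒮 A S N 0 PUnit.unit

end Filter

/-- `G` is a valid `(ε, δ)`-DP filter: for all algorithms (given by Markov kernels) and every
number `N` of rounds, adaptive composition with the filter `G` is `(ε, δ)`-DP. The decision to
continue after `k` rounds has to be a measurable event of the first `k` reports, as otherwise the
output has no law. The parameters are computed over `𝒮`, and the guarantee is for the pairs in `𝒮`;
`𝒮 = removalPairs 𝒳` is the usual case. -/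
def IsDPFilter (ε δ : ℝ) (G : List ℝ≥0∞ → Answer) : Prop :=
  ∀ (𝒳 : Type u) (𝒮 : Set (List 𝒳 × List 𝒳)), IsSymmetric 𝒮 →
  ∀ (𝒴 : ℕ → Type v) [∀ t, MeasurableSpace (𝒴 t)] (A : AlgSeq 𝒳 𝒴)
    [∀ t S, IsMarkovKernel (A t S)] (N : ℕ),
    (∀ k < N, MeasurableSet {h : Hist 𝒴 k | G (epsList 𝒮 A k h) = Answer.CONT}) →
    IsDP 𝒮 ε δ (filteredComposition G 𝒮 A N)

/-- The filter that continues as long as `½ ∑ ε_t² ≤ B`. -/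
def sumSqFilter (B : ℝ) (l : List ℝ≥0∞) : Answer :=
  if (l.map fun ε => ε ^ 2).sum / 2 ≤ ENNReal.ofReal B then Answer.CONT else Answer.HALT

/-- The usual set of pairs of datasets is symmetric. -/
theorem isSymmetric_removalPairs (𝒳 : Type u) : IsSymmetric (removalPairs 𝒳) := by
  rintro S S' ⟨T, i, h | h⟩
  · cases h
    exact ⟨S, i, Or.inr rfl⟩
  · cases h
    exact ⟨S', i, Or.inl rfl⟩

end DPFilter

end

noncomputable section

namespace DPFilter


/-! Differential privacy concerns one event `E` at a time, so only the law of the indicator of `E`,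
a Bernoulli law, matters. By data processing, a zCDP bound passes to these laws; conversely, a pair
of close Bernoulli laws is itself a zCDP algorithm. Hence "`B`-zCDP implies DP" is equivalent to
`BernImpliesDP`, a statement about two numbers `p`, `q` (`zCDPImpliesDP_iff`).

The filter: a round with pure parameter `ε` has Rényi moment at most `exp (α (α - 1) ε² / 2)`
(`lintegral_rnDeriv_rpow_le`). Given the past, `ε` is a fixed number, so by backward induction the
moment of `E` in the rest of the run is at most `exp (α (α - 1) b)`, where `b` is the unspent budget
`B - ½ ∑ ε_t²` (`eventMoment_runFrom_le`). At the start `b = B`, and `BernImpliesDP` gives the DP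
inequality for `E`. Thus one and the same level serves for zCDP algorithms and for the filter.

The largest level: admissible levels are downward closed, some positive level is admissible and they
are bounded above. The supremum is attained because a pair violating DP at level `B`, mixed
slightly, still violates it at some level below `B` (`bernImpliesDP_of_forall_lt`). -/

/-! ### The Rényi moments of two Bernoulli laws -/

/-- `exp ((α - 1) D_α)` for the Bernoulli laws with parameters `p` and `q`. -/
def bernMoment (α p q : ℝ) : ℝ :=
  p ^ α * q ^ (1 - α) + (1 - p) ^ α * (1 - q) ^ (1 - α)

/-- The Bernoulli laws with parameters `p` and `q` are as close as `B`-zCDP requires. -/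
def BernClose (B p q : ℝ) : Prop :=
  ∀ α : ℝ, 1 < α → bernMoment α p q ≤ Real.exp (α * (α - 1) * B)

/-- `B`-zCDP implies `(ε, δ)`-DP for nondegenerate Bernoulli laws. -/
def BernImpliesDP (B ε δ : ℝ) : Prop :=
  ∀ p ∈ Set.Ioo (0 : ℝ) 1, ∀ q ∈ Set.Ioo (0 : ℝ) 1, BernClose B p q → BernClose B q p →
    p ≤ Real.exp ε * q + δ

theorem BernClose.mono {B B' p q : ℝ} (hB : B ≤ B') (h : BernClose B p q) :
    BernClose B' p q := fun α hα =>
  (h α hα).trans <| Real.exp_le_exp.2 <|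
    mul_le_mul_of_nonneg_left hB (mul_nonneg (by linarith) (by linarith))

theorem BernImpliesDP.anti {B B' ε δ : ℝ} (hB : B ≤ B') (h : BernImpliesDP B' ε δ) :
    BernImpliesDP B ε δ :=
  fun p hp q hq h₁ h₂ => h p hp q hq (h₁.mono hB) (h₂.mono hB)

theorem rpow_mul_rpow_one_sub {p q : ℝ} (hp : 0 < p) (hq : 0 < q) (α : ℝ) :
    p ^ α * q ^ (1 - α) = p * (p / q) ^ (α - 1) := by
  rw [Real.div_rpow hp.le hq.le, ← neg_sub α 1, Real.rpow_neg hq.le, Real.rpow_sub_one hp.ne']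
  field_simp

theorem rpow_mul_rpow_one_sub_le {p q C α : ℝ} (hp : 0 < p) (hq : 0 < q) (hα : 1 < α)
    (h : p ≤ C * q) : p ^ α * q ^ (1 - α) ≤ p * C ^ (α - 1) := by
  rw [rpow_mul_rpow_one_sub hp hq]
  gcongr
  rwa [div_le_iff₀ hq]

/-- The moment is the mean of the `(α - 1)`-th power of the likelihood ratio under the first law.
The logarithm of the bound is linear in `α`, so for large `α` it beats the quadratic `α (α - 1) B`.
-/
theorem bernMoment_le_of_ratio_le {p q C α : ℝ} (hp : p ∈ Set.Ioo (0 : ℝ) 1)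
    (hq : q ∈ Set.Ioo (0 : ℝ) 1) (hα : 1 < α) (h₁ : p ≤ C * q) (h₂ : 1 - p ≤ C * (1 - q)) :
    bernMoment α p q ≤ C ^ (α - 1) := by
  have e₁ := rpow_mul_rpow_one_sub_le hp.1 hq.1 hα h₁
  have e₂ := rpow_mul_rpow_one_sub_le (sub_pos.2 hp.2) (sub_pos.2 hq.2) hα h₂
  unfold bernMoment
  linarith

theorem bernMoment_self {p α : ℝ} (hp : p ∈ Set.Ioo (0 : ℝ) 1) : bernMoment α p p = 1 := by
  have h1 : 0 < 1 - p := sub_pos.2 hp.2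
  unfold bernMoment
  rw [rpow_mul_rpow_one_sub hp.1 hp.1, rpow_mul_rpow_one_sub h1 h1, div_self hp.1.ne',
    div_self h1.ne', Real.one_rpow]
  ring

/-! ### Moments of mixtures -/

theorem rpow_neg_mix_le {x y s η : ℝ} (hx : 0 < x) (hy : 0 < y) (hs : s ≤ 0) (h0 : 0 ≤ η)
    (h1 : η ≤ 1) : ((1 - η) * x + η * y) ^ s ≤ (1 - η) * x ^ s + η * y ^ s := by
  have hmix : 0 < (1 - η) * x + η * y := by
    rcases h0.eq_or_lt with rfl | h0
    · simpa using hx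
    · have := mul_pos h0 hy
      have := mul_nonneg (sub_nonneg.2 h1) hx.le
      linarith
  -- Write `x ^ s = exp (s log x)`: as `s ≤ 0`, the exponent is convex in `x`, and `exp` is convex
  -- and increasing.
  have hlog := strictConcaveOn_log_Ioi.concaveOn.2 (x := x) hx (y := y) hy
    (sub_nonneg.2 h1) h0 (by ring)
  have hexp := convexOn_exp.2 (x := Real.log x * s) trivial (y := Real.log y * s) trivial
    (sub_nonneg.2 h1) h0 (by ring)
  simp only [smul_eq_mul] at hlog hexp
  rw [Real.rpow_def_of_pos hmix, Real.rpow_def_of_pos hx, Real.rpow_def_of_pos hy]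
  refine le_trans (Real.exp_le_exp.2 ?_) hexp
  nlinarith

theorem rpow_mix_le {x y s η : ℝ} (hx : 0 < x) (hy : 0 < y) (hs : 1 ≤ s) (h0 : 0 ≤ η)
    (h1 : η ≤ 1) : ((1 - η) * x + η * y) ^ s ≤ (1 - η) * x ^ s + η * y ^ s := by
  simpa using (convexOn_rpow hs).2 (x := x) hx.le (y := y) hy.le (sub_nonneg.2 h1) h0 (by ring)

/-- The moment is convex in its first argument and equals 1 when the two laws agree. -/
theorem bernMoment_mix_left_le {p q α η : ℝ} (hp : p ∈ Set.Ioo (0 : ℝ) 1)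
    (hq : q ∈ Set.Ioo (0 : ℝ) 1) (hα : 1 < α) (h0 : 0 ≤ η) (h1 : η ≤ 1) :
    bernMoment α ((1 - η) * p + η * q) q ≤ (1 - η) * bernMoment α p q + η := by
  have e₁ := rpow_mix_le hp.1 hq.1 hα.le h0 h1
  have e₂ := rpow_mix_le (sub_pos.2 hp.2) (sub_pos.2 hq.2) hα.le h0 h1
  have e₃ : 1 - ((1 - η) * p + η * q) = (1 - η) * (1 - p) + η * (1 - q) := by ring
  have e₄ : bernMoment α q q = 1 := bernMoment_self hq
  have := mul_le_mul_of_nonneg_right e₁ (Real.rpow_nonneg hq.1.le (1 - α))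
  have := mul_le_mul_of_nonneg_right e₂ (Real.rpow_nonneg (sub_pos.2 hq.2).le (1 - α))
  calc bernMoment α ((1 - η) * p + η * q) q
      ≤ (1 - η) * bernMoment α p q + η * bernMoment α q q := by
        unfold bernMoment
        rw [e₃]
        linarith
    _ = _ := by rw [e₄, mul_one]

theorem bernMoment_mix_right_le {p q α η : ℝ} (hp : p ∈ Set.Ioo (0 : ℝ) 1)
    (hq : q ∈ Set.Ioo (0 : ℝ) 1) (hα : 1 < α) (h0 : 0 ≤ η) (h1 : η ≤ 1) :
    bernMoment α q ((1 - η) * p + η * q) ≤ (1 - η) * bernMoment α q p + η := by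
  have e₁ := rpow_neg_mix_le hp.1 hq.1 (s := 1 - α) (by linarith) h0 h1
  have e₂ := rpow_neg_mix_le (sub_pos.2 hp.2) (sub_pos.2 hq.2) (s := 1 - α) (by linarith) h0 h1
  have e₃ : 1 - ((1 - η) * p + η * q) = (1 - η) * (1 - p) + η * (1 - q) := by ring
  have e₄ : bernMoment α q q = 1 := bernMoment_self hq
  have := mul_le_mul_of_nonneg_left e₁ (Real.rpow_nonneg hq.1.le α)
  have := mul_le_mul_of_nonneg_left e₂ (Real.rpow_nonneg (sub_pos.2 hq.2).le α)
  calc bernMoment α q ((1 - η) * p + η * q)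
      ≤ (1 - η) * bernMoment α q p + η * bernMoment α q q := by
        unfold bernMoment
        rw [e₃]
        linarith
    _ = _ := by rw [e₄, mul_one]

/-! ### The set of admissible levels -/

/-- Order 2 suffices: the moment is `1 + (p - q)² / (q (1 - q))`, and `q (1 - q) ≤ 1/4`. The level
makes the bound at order 2 equal to `1 + 4 δ²`, so that `|p - q| ≤ δ`. -/
theorem exists_bernImpliesDP {ε δ : ℝ} (hε : 0 ≤ ε) (hδ : 0 < δ) :
    ∃ B : ℝ, 0 < B ∧ BernImpliesDP B ε δ := by
  refine ⟨Real.log (1 + 4 * δ ^ 2) / 2, ?_, fun p hp q hq h _ => ?_⟩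
  · have : 0 < δ ^ 2 := by positivity
    exact div_pos (Real.log_pos (by linarith)) two_pos
  · have h2 := h 2 one_lt_two
    have e : (2 : ℝ) * (2 - 1) * (Real.log (1 + 4 * δ ^ 2) / 2) = Real.log (1 + 4 * δ ^ 2) := by
      ring
    have hq1 : 0 < 1 - q := sub_pos.2 hq.2
    have hq0 := hq.1
    rw [e, Real.exp_log (by positivity)] at h2
    have hm : bernMoment 2 p q = 1 + (p - q) ^ 2 / (q * (1 - q)) := by
      unfold bernMoment
      have e1 : (1 : ℝ) - 2 = -1 := by norm_num
      rw [e1, Real.rpow_neg_one, Real.rpow_neg_one, Real.rpow_two, Real.rpow_two]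
      field_simp
      ring
    rw [hm, add_le_add_iff_left, div_le_iff₀ (mul_pos hq0 hq1)] at h2
    have h3 : (p - q) ^ 2 ≤ δ ^ 2 := by
      have : 4 * (q * (1 - q)) ≤ 1 := by nlinarith [sq_nonneg (1 - 2 * q)]
      nlinarith [sq_nonneg δ]
    have h4 := abs_le_of_sq_le_sq' h3 hδ.le
    have h5 : 1 * q ≤ Real.exp ε * q := by
      gcongr
      exact Real.one_le_exp hε
    linarith [h4.2]

/-- Any nondegenerate pair has likelihood ratios bounded by some `C`, hence is close at level `log
C`. The pair chosen has `exp ε * q + δ = (1 + 3 δ) / 4 < (1 + δ) / 2 = p`. -/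
theorem exists_not_bernImpliesDP {ε δ : ℝ} (hε : 0 ≤ ε) (hδ0 : 0 < δ) (hδ1 : δ < 1) :
    ∃ B : ℝ, ¬ BernImpliesDP B ε δ := by
  have hee : Real.exp ε * Real.exp (-ε) = 1 := by rw [← Real.exp_add]; simp
  have he1 : Real.exp (-ε) ≤ 1 := Real.exp_le_one_iff.2 (by linarith)
  have he0 := Real.exp_pos (-ε)
  set p := (1 + δ) / 2 with hp
  set q := Real.exp (-ε) * ((1 - δ) / 4) with hq
  have hq0 : 0 < q := mul_pos he0 (by linarith)
  have hq1 : q ≤ (1 - δ) / 4 := by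
    have := mul_le_mul_of_nonneg_right he1 (show 0 ≤ (1 - δ) / 4 by linarith)
    linarith
  have hpI : p ∈ Set.Ioo (0 : ℝ) 1 := ⟨by linarith, by linarith⟩
  have hqI : q ∈ Set.Ioo (0 : ℝ) 1 := ⟨hq0, by linarith⟩
  have hqp : q ≤ p := by linarith
  set C := max (p / q) ((1 - q) / (1 - p)) with hC
  have c1 : p ≤ C * q := (div_le_iff₀ hq0).1 (le_max_left _ _)
  have c2 : 1 - q ≤ C * (1 - p) := (div_le_iff₀ (by linarith [hpI.2])).1 (le_max_right _ _)
  have hC1 : 1 ≤ C := le_trans ((one_le_div hq0).2 hqp) (le_max_left _ _)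
  have c3 : q ≤ C * p := hqp.trans (le_mul_of_one_le_left hpI.1.le hC1)
  have c4 : 1 - p ≤ C * (1 - q) := by
    have := le_mul_of_one_le_left (sub_nonneg.2 hqI.2.le) hC1
    linarith
  have key : ∀ α : ℝ, 1 < α → C ^ (α - 1) ≤ Real.exp (α * (α - 1) * Real.log C) := by
    intro α hα
    rw [Real.rpow_def_of_pos (by linarith), Real.exp_le_exp]
    have := mul_nonneg (Real.log_nonneg hC1) (sq_nonneg (α - 1))
    nlinarith
  refine ⟨Real.log C, fun h => ?_⟩
  have := h p hpI q hqI
    (fun α hα => (bernMoment_le_of_ratio_le hpI hqI hα c1 c4).trans (key α hα))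
    (fun α hα => (bernMoment_le_of_ratio_le hqI hpI hα c3 c2).trans (key α hα))
  rw [hq, ← mul_assoc, hee] at this
  linarith

/-- The set of admissible levels is closed from below. -/
theorem bernImpliesDP_of_forall_lt {B ε δ : ℝ} (hε : 0 ≤ ε) (hδ : 0 < δ) (hB : 0 < B)
    (h : ∀ B' < B, BernImpliesDP B' ε δ) : BernImpliesDP B ε δ := by
  intro p hp q hq hpq hqp
  -- Moving `p` slightly towards `q` keeps the strict violation. It remains to find one `B' < B` at
  -- which the new pair is close for all orders at once.
  by_contra! hlt
  have hp0 := hp.1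
  have hq0 := hq.1
  have hp1 : 0 < 1 - p := sub_pos.2 hp.2
  have hq1 : 0 < 1 - q := sub_pos.2 hq.2
  have hqltp : q < p := by
    have : 1 * q ≤ Real.exp ε * q := by
      gcongr
      exact Real.one_le_exp hε
    linarith
  -- a mixture that still violates the inequality
  obtain ⟨η, hη0, hη1, hη⟩ : ∃ η : ℝ, 0 < η ∧ η < 1 ∧
      Real.exp ε * q + δ < (1 - η) * p + η * q := by
    set d := p - (Real.exp ε * q + δ) with hd
    have hd0 : 0 < d := sub_pos.2 hlt
    have hd1 : d < 1 := by
      have := mul_pos (Real.exp_pos ε) hq0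
      linarith [hp.2]
    refine ⟨d / 2, by linarith, by linarith, ?_⟩
    have : d / 2 * (p - q) ≤ d / 2 * 1 := by
      gcongr
      linarith [hp.2]
    linarith
  set p' := (1 - η) * p + η * q with hp'
  have hp'q : q ≤ p' := by nlinarith
  have hp'p : p' ≤ p := by nlinarith
  have hp'I : p' ∈ Set.Ioo (0 : ℝ) 1 := ⟨by linarith, by linarith [hp.2]⟩
  set C := max (p / q) ((1 - q) / (1 - p)) with hC
  have c1 : p ≤ C * q := (div_le_iff₀ hq0).1 (le_max_left _ _)
  have c2 : 1 - q ≤ C * (1 - p) := (div_le_iff₀ hp1).1 (le_max_right _ _)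
  have hC1 : 1 ≤ C := le_trans ((one_le_div hq0).2 hqltp.le) (le_max_left _ _)
  have c3 : q ≤ C * p' := hp'q.trans (le_mul_of_one_le_left hp'I.1.le hC1)
  have c4 : 1 - p' ≤ C * (1 - q) := by
    have := le_mul_of_one_le_left hq1.le hC1
    linarith
  have c5 : 1 - q ≤ C * (1 - p') := c2.trans (by gcongr)
  have hL : 0 ≤ Real.log C := Real.log_nonneg hC1
  -- From order `a` on, the ratio bound `C ^ (α - 1)` already gives level `B / 2`. Below `a`, the
  -- gain comes from mixing.
  set a := max 2 (2 * Real.log C / B) with ha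
  have ha2 : 2 ≤ a := le_max_left _ _
  have haL : 2 * Real.log C ≤ a * B := (div_le_iff₀ hB).1 (le_max_right _ _)
  set X := a * (a - 1) with hX
  have hX0 : 0 < X := mul_pos (by linarith) (by linarith)
  set Y := Real.exp (X * B) with hY
  have hY1 : 1 < Y := Real.one_lt_exp_iff.2 (mul_pos hX0 hB)
  set Z := (1 - η) * Y + η with hZ
  have hZY : Z < Y := by nlinarith
  have hZ1 : 1 < Z := by nlinarith
  have hZlog : Real.log Z / X < B := by
    rw [div_lt_iff₀ hX0, Real.log_lt_iff_lt_exp (by linarith), mul_comm]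
    exact hZY
  set B' := max (Real.log Z / X) (B / 2) with hB'
  have hB'lt : B' < B := max_lt hZlog (by linarith)
  have key : ∀ α : ℝ, 1 < α → ∀ m m' : ℝ, m ≤ Real.exp (α * (α - 1) * B) →
      m' ≤ (1 - η) * m + η → m' ≤ C ^ (α - 1) → m' ≤ Real.exp (α * (α - 1) * B') := by
    intro α hα m m' hm hm' hmC
    have hαα : 0 ≤ α * (α - 1) := mul_nonneg (by linarith) (by linarith)
    rcases le_total α a with hαa | hαa
    · set s := α * (α - 1) / X with hs
      have hs0 : 0 ≤ s := div_nonneg hαα hX0.le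
      have hs1 : s ≤ 1 := by
        rw [hs, div_le_one hX0]
        exact mul_le_mul hαa (by linarith) (by linarith) (by linarith)
      have hsX : s * X = α * (α - 1) := div_mul_cancel₀ _ hX0.ne'
      have hYs : Real.exp (α * (α - 1) * B) = Y ^ s := by
        rw [hY, ← Real.exp_mul, ← hsX]
        ring_nf
      -- Concavity of `y ↦ y ^ s` for `s ∈ [0, 1]` gives `(1 - η) Y ^ s + η ≤ Z ^ s`: the strict
      -- gain `Z < Y` at order `a` carries over to all smaller orders, with the common level `log Z
      -- / X`.
      have hconc := (Real.concaveOn_rpow hs0 hs1).2 (x := Y) (by simp; linarith) (y := (1 : ℝ))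
        (by simp) (sub_nonneg.2 hη1.le) hη0.le (by ring)
      simp only [smul_eq_mul, Real.one_rpow, mul_one] at hconc
      calc m' ≤ (1 - η) * m + η := hm'
        _ ≤ (1 - η) * Y ^ s + η := by
          rw [← hYs]
          have := mul_le_mul_of_nonneg_left hm (sub_nonneg.2 hη1.le)
          linarith
        _ ≤ Z ^ s := hconc
        _ = Real.exp (α * (α - 1) * (Real.log Z / X)) := by
          rw [Real.rpow_def_of_pos (by linarith), hs]
          ring_nf
        _ ≤ _ := by
          gcongr
          exact le_max_left _ _
    · refine hmC.trans ?_
      rw [Real.rpow_def_of_pos (by linarith), Real.exp_le_exp]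
      have h1 : Real.log C ≤ α * (B / 2) := by
        have := mul_le_mul_of_nonneg_right hαa hB.le
        linarith
      have h2 : B / 2 ≤ B' := le_max_right _ _
      calc Real.log C * (α - 1) ≤ α * (B / 2) * (α - 1) := by gcongr
        _ = α * (α - 1) * (B / 2) := by ring
        _ ≤ _ := by gcongr
  refine absurd (h B' hB'lt p' hp'I q hq (fun α hα => ?_) (fun α hα => ?_)) (not_le.2 hη)
  · exact key α hα _ _ (hpq α hα) (bernMoment_mix_left_le hp hq hα hη0.le hη1.le)
      (bernMoment_le_of_ratio_le hp'I hq hα (hp'p.trans c1) c4)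
  · exact key α hα _ _ (hqp α hα) (bernMoment_mix_right_le hp hq hα hη0.le hη1.le)
      (bernMoment_le_of_ratio_le hq hp'I hα c3 c5)

theorem exists_isGreatest_bernImpliesDP {ε δ : ℝ} (hε : 0 ≤ ε) (hδ0 : 0 < δ) (hδ1 : δ < 1) :
    ∃ B, IsGreatest {B : ℝ | 0 < B ∧ BernImpliesDP B ε δ} B := by
  obtain ⟨B₁, hB₁⟩ := exists_bernImpliesDP hε hδ0
  obtain ⟨B₂, hB₂⟩ := exists_not_bernImpliesDP hε hδ0 hδ1
  have hbdd : BddAbove {B : ℝ | 0 < B ∧ BernImpliesDP B ε δ} :=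
    ⟨B₂, fun B hB => le_of_not_ge fun hle => hB₂ (hB.2.anti hle)⟩
  refine ⟨sSup {B : ℝ | 0 < B ∧ BernImpliesDP B ε δ}, ?_, fun B hB => le_csSup hbdd hB⟩
  have hpos := hB₁.1.trans_le (le_csSup hbdd hB₁)
  refine ⟨hpos, bernImpliesDP_of_forall_lt hε hδ0 hpos fun B' hB' => ?_⟩
  obtain ⟨B, hB, hlt⟩ := exists_lt_of_lt_csSup ⟨B₁, hB₁⟩ hB'
  exact hB.2.anti hlt.le

/-- The explicit admissible level. -/
theorem bernImpliesDP_explicit {ε δ : ℝ} (hε : 0 ≤ ε) (hδ0 : 0 < δ) (hδ1 : δ < 1) :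
    BernImpliesDP ((-Real.sqrt (Real.log (1 / δ)) + Real.sqrt (Real.log (1 / δ) + ε)) ^ 2)
      ε δ := by
  -- For `ε = 0` the level is 0 and the order chosen below would divide by zero.
  rcases hε.eq_or_lt with rfl | hε
  · obtain ⟨B, hB, h⟩ := exists_bernImpliesDP le_rfl hδ0
    refine h.anti ?_
    simpa using hB.le
  set L := Real.log (1 / δ) with hL
  have hL0 : 0 < L := Real.log_pos (by rw [lt_div_iff₀ hδ0]; linarith)
  set l := Real.sqrt L with hl
  set m := Real.sqrt (L + ε) with hm
  have hl2 : l ^ 2 = L := Real.sq_sqrt hL0.le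
  have hm2 : m ^ 2 = L + ε := Real.sq_sqrt (by linarith)
  have hl0 : 0 < l := Real.sqrt_pos.2 hL0
  have hlm : l < m := Real.sqrt_lt_sqrt hL0.le (by linarith)
  intro p hp q hq h _
  rcases le_or_gt p (Real.exp ε * q) with hle | hgt
  · linarith
  have hr0 : 0 < m - l := sub_pos.2 hlm
  -- This order minimizes `α (α - 1) B - (α - 1) ε` for `B = (m - l)²`; the minimum is `-log (1 /
  -- δ)`.
  set α := 1 + l / (m - l) with hα
  have hα1 : 1 < α := by
    have := div_pos hl0 hr0
    linarith
  have hexp : α * (α - 1) * (-l + m) ^ 2 = (α - 1) * ε - L := by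
    have : ε = m ^ 2 - l ^ 2 := by linarith
    rw [this, ← hl2, hα]
    field_simp
    ring
  -- As in Markov's inequality: keep only the first term of the moment, where the ratio exceeds `exp
  -- ε`.
  have h1 : p * Real.exp ((α - 1) * ε) ≤ Real.exp (α * (α - 1) * (-l + m) ^ 2) := by
    refine le_trans ?_ (h α hα1)
    have h2 : 0 ≤ (1 - p) ^ α * (1 - q) ^ (1 - α) :=
      mul_nonneg (Real.rpow_nonneg (sub_nonneg.2 hp.2.le) _)
        (Real.rpow_nonneg (sub_nonneg.2 hq.2.le) _)
    have h3 : p * Real.exp ((α - 1) * ε) ≤ p ^ α * q ^ (1 - α) := by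
      rw [rpow_mul_rpow_one_sub hp.1 hq.1, mul_comm (α - 1), Real.exp_mul]
      have := hp.1
      gcongr
      rw [le_div_iff₀ hq.1]
      exact hgt.le
    unfold bernMoment
    linarith
  rw [hexp, Real.exp_sub, le_div_iff₀ (Real.exp_pos _), mul_right_comm,
    mul_le_iff_le_one_left (Real.exp_pos _), hL, Real.exp_log (by positivity),
    mul_one_div, div_le_one hδ0] at h1
  have := mul_pos (Real.exp_pos ε) hq.1
  linarith


/-! ### Rényi moments of events -/

/-- Joint convexity of `(x, y) ↦ x ^ α * y ^ (1 - α)`, in integrated form. -/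
theorem lintegral_rpow_mul_lintegral_rpow_le {Ω : Type*} [MeasurableSpace Ω] {ν : Measure Ω}
    {f g : Ω → ℝ≥0∞} (hf : Measurable f) (hg : Measurable g) (hg1 : ∀ x, g x ≠ ⊤)
    (hgi : ∫⁻ x, g x ∂ν ≠ ⊤) {α : ℝ} (hα : 1 < α) :
    (∫⁻ x, f x ∂ν) ^ α * (∫⁻ x, g x ∂ν) ^ (1 - α) ≤ ∫⁻ x, f x ^ α * g x ^ (1 - α) ∂ν := by
  have hα0 : 0 < α := by linarith
  set I := ∫⁻ x, f x ^ α * g x ^ (1 - α) ∂ν with hI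
  by_cases hIt : I = ⊤
  · rw [hIt]; exact le_top
  have hmeas : Measurable fun x => f x ^ α * g x ^ (1 - α) := by fun_prop
  -- This factorization prepares Hölder's inequality with weights `1 / α` and `(α - 1) / α`. Where
  -- `g = 0`, finiteness of the integral forces `f = 0` almost everywhere, since `0 ^ (1 - α) = ⊤`.
  have hae : ∀ᵐ x ∂ν, f x = (f x ^ α * g x ^ (1 - α)) ^ (1 / α) * g x ^ ((α - 1) / α) := by
    filter_upwards [ae_lt_top hmeas hIt] with x hx
    rcases eq_or_ne (g x) 0 with h0 | h0
    · have hfx : f x = 0 := by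
        by_contra hne
        rw [h0, ENNReal.zero_rpow_of_neg (by linarith), ENNReal.mul_top] at hx
        · exact lt_irrefl _ hx
        · simp [ENNReal.rpow_eq_zero_iff, hne]
          intro _
          linarith
      simp [hfx, h0, hα0]
    · rw [ENNReal.mul_rpow_of_nonneg _ _ (by positivity), ← ENNReal.rpow_mul, ← ENNReal.rpow_mul,
        mul_assoc, ← ENNReal.rpow_add _ _ h0 (hg1 x)]
      have e1 : α * (1 / α) = 1 := by field_simp
      have e2 : (1 - α) * (1 / α) + (α - 1) / α = 0 := by field_simp; ring
      rw [e1, e2]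
      simp
  have hH : ∫⁻ x, f x ∂ν ≤ I ^ (1 / α) * (∫⁻ x, g x ∂ν) ^ ((α - 1) / α) := by
    rw [lintegral_congr_ae hae]
    exact ENNReal.lintegral_mul_norm_pow_le hmeas.aemeasurable hg.aemeasurable (by positivity)
      (div_nonneg (by linarith) hα0.le) (by field_simp; ring)
  have hH' : (∫⁻ x, f x ∂ν) ^ α ≤ I * (∫⁻ x, g x ∂ν) ^ (α - 1) := by
    refine (ENNReal.rpow_le_rpow hH hα0.le).trans_eq ?_
    rw [ENNReal.mul_rpow_of_nonneg _ _ hα0.le, ← ENNReal.rpow_mul, ← ENNReal.rpow_mul]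
    have e1 : 1 / α * α = 1 := by field_simp
    have e2 : (α - 1) / α * α = α - 1 := by field_simp
    rw [e1, e2, ENNReal.rpow_one]
  rcases eq_or_ne (∫⁻ x, g x ∂ν) 0 with h0 | h0
  · rw [h0, ENNReal.zero_rpow_of_pos (by linarith), mul_zero] at hH'
    rw [le_antisymm hH' bot_le, zero_mul]
    exact bot_le
  · refine (mul_le_mul_left hH' _).trans_eq ?_
    rw [mul_assoc, ← ENNReal.rpow_add _ _ h0 hgi]
    simp

/-- `exp ((α - 1) D_α)` for the laws of the indicator of `E` under `μ` and `ν`. -/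
def eventMoment {Ω : Type*} [MeasurableSpace Ω] (α : ℝ) (μ ν : Measure Ω) (E : Set Ω) : ℝ≥0∞ :=
  μ E ^ α * ν E ^ (1 - α) + μ Eᶜ ^ α * ν Eᶜ ^ (1 - α)

/-- The data processing inequality for a pair of Markov kernels applied to `μ ≪ ν`. -/
theorem eventMoment_bind_le {Ω Ω' : Type*} [MeasurableSpace Ω] [MeasurableSpace Ω']
    {μ ν : Measure Ω} [IsProbabilityMeasure μ] [IsProbabilityMeasure ν] (hμν : μ ≪ ν)
    {κ η : Ω → Measure Ω'} (hκ : Measurable κ) (hη : Measurable η)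
    [∀ x, IsProbabilityMeasure (η x)]
    {E : Set Ω'} (hE : MeasurableSet E) {α : ℝ} (hα : 1 < α) {c : ℝ≥0∞}
    (hc : ∀ x, eventMoment α (κ x) (η x) E ≤ c) :
    eventMoment α (μ.bind κ) (ν.bind η) E ≤ c * ∫⁻ x, μ.rnDeriv ν x ^ α ∂ν := by
  have hα0 : 0 ≤ α := by linarith
  have hr := Measure.measurable_rnDeriv μ ν
  have part : ∀ F : Set Ω', MeasurableSet F → μ.bind κ F ^ α * ν.bind η F ^ (1 - α) ≤
      ∫⁻ x, μ.rnDeriv ν x ^ α * (κ x F ^ α * η x F ^ (1 - α)) ∂ν := by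
    intro F hF
    have hκF : Measurable fun x => κ x F := (Measure.measurable_coe hF).comp hκ
    have hηF : Measurable fun x => η x F := (Measure.measurable_coe hF).comp hη
    rw [Measure.bind_apply hF hκ.aemeasurable, Measure.bind_apply hF hη.aemeasurable,
      ← lintegral_rnDeriv_mul hμν hκF.aemeasurable]
    have hfin : ∫⁻ x, η x F ∂ν ≠ ⊤ := by
      refine ne_top_of_le_ne_top ENNReal.one_ne_top ?_
      calc ∫⁻ x, η x F ∂ν ≤ ∫⁻ _, 1 ∂ν := lintegral_mono fun x => prob_le_one
        _ = 1 := by simp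
    refine (lintegral_rpow_mul_lintegral_rpow_le (hr.mul hκF) hηF
      (fun x => measure_ne_top _ _) hfin hα).trans_eq ?_
    refine lintegral_congr fun x => ?_
    simp only [Pi.mul_apply]
    rw [ENNReal.mul_rpow_of_nonneg _ _ hα0, mul_assoc]
  have hκE : Measurable fun x => κ x E := (Measure.measurable_coe hE).comp hκ
  have hηE : Measurable fun x => η x E := (Measure.measurable_coe hE).comp hη
  calc eventMoment α (μ.bind κ) (ν.bind η) E
      ≤ ∫⁻ x, μ.rnDeriv ν x ^ α * (κ x E ^ α * η x E ^ (1 - α)) ∂ν +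
        ∫⁻ x, μ.rnDeriv ν x ^ α * (κ x Eᶜ ^ α * η x Eᶜ ^ (1 - α)) ∂ν :=
        add_le_add (part E hE) (part Eᶜ hE.compl)
    _ = ∫⁻ x, μ.rnDeriv ν x ^ α * eventMoment α (κ x) (η x) E ∂ν := by
        rw [← lintegral_add_left (by fun_prop)]
        simp only [eventMoment, mul_add]
    _ ≤ ∫⁻ x, μ.rnDeriv ν x ^ α * c ∂ν := by
        refine lintegral_mono fun x => ?_
        dsimp only
        gcongr
        exact hc x
    _ = _ := by rw [lintegral_mul_const _ (by fun_prop), mul_comm]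

theorem eventMoment_dirac {Ω : Type*} [MeasurableSpace Ω] (x : Ω) {E : Set Ω}
    (hE : MeasurableSet E) {α : ℝ} (hα : 1 < α) :
    eventMoment α (Measure.dirac x) (Measure.dirac x) E = 1 := by
  have hα0 : 0 < α := by linarith
  unfold eventMoment
  rw [Measure.dirac_apply' _ hE, Measure.dirac_apply' _ hE.compl]
  by_cases hx : x ∈ E <;> simp [hx, hα0]

theorem eventMoment_le_lintegral_rnDeriv {Ω : Type*} [MeasurableSpace Ω] {μ ν : Measure Ω}
    [IsProbabilityMeasure μ] [IsProbabilityMeasure ν] (hμν : μ ≪ ν) {E : Set Ω}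
    (hE : MeasurableSet E) {α : ℝ} (hα : 1 < α) :
    eventMoment α μ ν E ≤ ∫⁻ x, μ.rnDeriv ν x ^ α ∂ν := by
  have := eventMoment_bind_le hμν Measure.measurable_dirac Measure.measurable_dirac hE hα
    (fun x => (eventMoment_dirac x hE hα).le)
  simpa [Measure.bind_dirac] using this

theorem eventMoment_eq_ofReal {Ω : Type*} [MeasurableSpace Ω] {μ ν : Measure Ω}
    [IsProbabilityMeasure μ] [IsProbabilityMeasure ν] {E : Set Ω} (hE : MeasurableSet E)
    (hμ : μ.real E ∈ Set.Ioo (0 : ℝ) 1) (hν : ν.real E ∈ Set.Ioo (0 : ℝ) 1) (α : ℝ) :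
    eventMoment α μ ν E = ENNReal.ofReal (bernMoment α (μ.real E) (ν.real E)) := by
  have hμ1 : 0 < 1 - μ.real E := sub_pos.2 hμ.2
  have hν1 : 0 < 1 - ν.real E := sub_pos.2 hν.2
  have hμ0 := hμ.1
  have hν0 := hν.1
  unfold eventMoment bernMoment
  rw [← ofReal_measureReal (μ := μ) (s := E), ← ofReal_measureReal (μ := ν) (s := E),
    ← ofReal_measureReal (μ := μ) (s := Eᶜ), ← ofReal_measureReal (μ := ν) (s := Eᶜ),
    probReal_compl_eq_one_sub hE, probReal_compl_eq_one_sub hE,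
    ENNReal.ofReal_rpow_of_pos hμ0, ENNReal.ofReal_rpow_of_pos hν0,
    ENNReal.ofReal_rpow_of_pos hμ1, ENNReal.ofReal_rpow_of_pos hν1,
    ← ENNReal.ofReal_mul (by positivity), ← ENNReal.ofReal_mul (by positivity),
    ← ENNReal.ofReal_add (by positivity) (by positivity)]

/-- Since `0 ^ (1 - α) = ⊤`, a finite moment encodes absolute continuity on the event. -/
theorem eq_zero_of_eventMoment_ne_top {Ω : Type*} [MeasurableSpace Ω] {μ ν : Measure Ω}
    {E : Set Ω} {α : ℝ} (hα : 1 < α) (h : eventMoment α μ ν E ≠ ⊤) (hν : ν E = 0) : μ E = 0 := by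
  by_contra hne
  apply h
  unfold eventMoment
  rw [hν, ENNReal.zero_rpow_of_neg (by linarith), ENNReal.mul_top, top_add]
  simp [ENNReal.rpow_eq_zero_iff, hne]
  intro _
  linarith

/-- Closeness of the moments of an event, with all degenerate cases included. -/
theorem real_le_of_eventMoment_le {B ε δ : ℝ} (hε : 0 ≤ ε) (hδ : 0 ≤ δ)
    (hB : BernImpliesDP B ε δ)
    {Ω : Type*} [MeasurableSpace Ω] {μ ν : Measure Ω}
    [IsProbabilityMeasure μ] [IsProbabilityMeasure ν] {E : Set Ω} (hE : MeasurableSet E)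
    (h₁ : ∀ α : ℝ, 1 < α →
      eventMoment α μ ν E ≤ ENNReal.ofReal (Real.exp (α * (α - 1) * B)))
    (h₂ : ∀ α : ℝ, 1 < α →
      eventMoment α ν μ E ≤ ENNReal.ofReal (Real.exp (α * (α - 1) * B))) :
    μ.real E ≤ Real.exp ε * ν.real E + δ := by
  have hν : ν.real E ≤ Real.exp ε * ν.real E :=
    le_mul_of_one_le_left measureReal_nonneg (Real.one_le_exp hε)
  rcases le_or_gt (μ.real E) (ν.real E) with hle | hlt
  · linarith
  have t₁ : eventMoment 2 μ ν E ≠ ⊤ :=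
    ne_top_of_le_ne_top ENNReal.ofReal_ne_top (h₁ 2 one_lt_two)
  have t₂ : eventMoment 2 ν μ Eᶜ ≠ ⊤ := by
    have e : eventMoment 2 ν μ Eᶜ = eventMoment 2 ν μ E := by
      simp only [eventMoment, compl_compl]
      exact add_comm _ _
    rw [e]
    exact ne_top_of_le_ne_top ENNReal.ofReal_ne_top (h₂ 2 one_lt_two)
  have hν0 : 0 < ν.real E := by
    refine lt_of_le_of_ne measureReal_nonneg fun h0 => ?_
    have := eq_zero_of_eventMoment_ne_top one_lt_two t₁
      ((measureReal_eq_zero_iff (measure_ne_top _ _)).1 h0.symm)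
    rw [← h0, (measureReal_eq_zero_iff (measure_ne_top _ _)).2 this] at hlt
    exact lt_irrefl _ hlt
  -- If `μ E = 1`, the reverse moment forces `ν Eᶜ = 0`, contradicting `ν E < μ E`.
  have hμ1 : μ.real E < 1 := by
    refine lt_of_le_of_ne measureReal_le_one fun h1 => ?_
    have hc : μ.real Eᶜ = 0 := by rw [probReal_compl_eq_one_sub hE, h1, sub_self]
    have := eq_zero_of_eventMoment_ne_top one_lt_two t₂
      ((measureReal_eq_zero_iff (measure_ne_top _ _)).1 hc)
    have h3 := (measureReal_eq_zero_iff (measure_ne_top ν Eᶜ)).2 this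
    rw [probReal_compl_eq_one_sub hE] at h3
    linarith
  have hμI : μ.real E ∈ Set.Ioo (0 : ℝ) 1 := ⟨hν0.trans hlt, hμ1⟩
  have hνI : ν.real E ∈ Set.Ioo (0 : ℝ) 1 := ⟨hν0, hlt.trans hμ1⟩
  refine hB _ hμI _ hνI (fun α hα => ?_) (fun α hα => ?_)
  · have := h₁ α hα
    rwa [eventMoment_eq_ofReal hE hμI hνI, ENNReal.ofReal_le_ofReal_iff (Real.exp_pos _).le]
      at this
  · have := h₂ α hα
    rwa [eventMoment_eq_ofReal hE hνI hμI, ENNReal.ofReal_le_ofReal_iff (Real.exp_pos _).le]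
      at this

/-! ### zCDP in terms of Bernoulli laws -/

theorem inv_mul_log_le_iff {α B : ℝ} (hα : 1 < α) (I : ℝ≥0∞) :
    (((α - 1)⁻¹ : ℝ) : EReal) * ENNReal.log I ≤ ((B * α : ℝ) : EReal) ↔
      I ≤ ENNReal.ofReal (Real.exp (α * (α - 1) * B)) := by
  have hpos : 0 < (α - 1)⁻¹ := inv_pos.2 (by linarith)
  rcases eq_or_ne I 0 with rfl | h0
  · simp [EReal.coe_mul_bot_of_pos hpos]
  rcases eq_or_ne I ⊤ with rfl | ht
  · rw [ENNReal.log_top, EReal.coe_mul_top_of_pos hpos]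
    simp only [top_le_iff, ENNReal.ofReal_ne_top, iff_false]
    exact EReal.coe_ne_top _
  have hI : 0 < I.toReal := ENNReal.toReal_pos h0 ht
  rw [ENNReal.log_pos_real h0 ht, ← EReal.coe_mul, EReal.coe_le_coe_iff,
    ENNReal.le_ofReal_iff_toReal_le ht (Real.exp_pos _).le, ← Real.log_le_iff_le_exp hI,
    inv_mul_le_iff₀ (by linarith)]
  ring_nf

theorem eventMoment_le_of_renyiDiv_le {Ω : Type*} [MeasurableSpace Ω] {μ ν : Measure Ω}
    [IsProbabilityMeasure μ] [IsProbabilityMeasure ν] {α B : ℝ} (hα : 1 < α)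
    (h : renyiDiv α μ ν ≤ ((B * α : ℝ) : EReal)) {E : Set Ω} (hE : MeasurableSet E) :
    eventMoment α μ ν E ≤ ENNReal.ofReal (Real.exp (α * (α - 1) * B)) := by
  unfold renyiDiv at h
  split_ifs at h with hac
  · exact (eventMoment_le_lintegral_rnDeriv hac hE hα).trans ((inv_mul_log_le_iff hα _).1 h)
  · exact absurd h (not_le.2 (EReal.coe_lt_top _))

theorem zCDPImpliesDP_of_bernImpliesDP {B ε δ : ℝ} (hε : 0 ≤ ε) (hδ : 0 ≤ δ)
    (hB : BernImpliesDP B ε δ) : ZCDPImpliesDP.{u, v} B ε δ := by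
  intro 𝒳 Ω _ M _ hM S S' hS E hE
  exact real_le_of_eventMoment_le hε hδ hB hE
    (fun α hα => eventMoment_le_of_renyiDiv_le hα (hM S S' hS α hα) hE)
    (fun α hα => eventMoment_le_of_renyiDiv_le hα
      (hM S' S (isSymmetric_removalPairs 𝒳 S S' hS) α hα) hE)

/-- The Bernoulli law with parameter `p`. -/
def bern (p : ℝ) : Measure (ULift.{v} Bool) :=
  ENNReal.ofReal p • Measure.dirac ⟨true⟩ + ENNReal.ofReal (1 - p) • Measure.dirac ⟨false⟩

theorem isProbabilityMeasure_bern {p : ℝ} (hp : p ∈ Set.Ioo (0 : ℝ) 1) :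
    IsProbabilityMeasure (bern.{v} p) := by
  refine ⟨?_⟩
  simp only [bern, Measure.coe_add, Measure.coe_smul, Pi.add_apply, Pi.smul_apply, measure_univ,
    smul_eq_mul, mul_one]
  rw [← ENNReal.ofReal_add hp.1.le (sub_nonneg.2 hp.2.le)]
  simp

theorem measurable_of_uLift_bool (f : ULift.{v} Bool → ℝ≥0∞) : Measurable f :=
  (Measurable.of_discrete (f := fun b : Bool => f ⟨b⟩)).comp
    (measurable_down : Measurable (ULift.down : ULift.{v} Bool → Bool))

theorem lintegral_bern (p : ℝ) (f : ULift.{v} Bool → ℝ≥0∞) :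
    ∫⁻ x, f x ∂bern p = ENNReal.ofReal p * f ⟨true⟩ + ENNReal.ofReal (1 - p) * f ⟨false⟩ := by
  have hf : Measurable f := measurable_of_uLift_bool f
  simp only [bern]
  rw [lintegral_add_measure, lintegral_smul_measure, lintegral_smul_measure, lintegral_dirac' _ hf,
    lintegral_dirac' _ hf, smul_eq_mul, smul_eq_mul]

theorem bern_real_true {p : ℝ} (hp : p ∈ Set.Ioo (0 : ℝ) 1) :
    (bern.{v} p).real {⟨true⟩} = p := by
  have : (bern.{v} p) {⟨true⟩} = ENNReal.ofReal p := by
    simp [bern]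
  rw [measureReal_def, this, ENNReal.toReal_ofReal hp.1.le]

theorem renyiDiv_bern_le {B p q : ℝ} (hp : p ∈ Set.Ioo (0 : ℝ) 1) (hq : q ∈ Set.Ioo (0 : ℝ) 1)
    (h : BernClose B p q) {α : ℝ} (hα : 1 < α) :
    renyiDiv α (bern.{v} p) (bern.{v} q) ≤ ((B * α : ℝ) : EReal) := by
  have := isProbabilityMeasure_bern.{v} hp
  have := isProbabilityMeasure_bern.{v} hq
  have hp1 : 0 < 1 - p := sub_pos.2 hp.2
  have hq1 : 0 < 1 - q := sub_pos.2 hq.2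
  have hp0 := hp.1
  have hq0 := hq.1
  set r : ULift.{v} Bool → ℝ≥0∞ := fun x =>
    if x.down then ENNReal.ofReal (p / q) else ENNReal.ofReal ((1 - p) / (1 - q)) with hr
  have hrm : Measurable r := measurable_of_uLift_bool r
  have heq : bern.{v} p = (bern.{v} q).withDensity r := by
    refine Measure.ext fun s hs => ?_
    rw [withDensity_apply _ hs, ← lintegral_indicator hs, ← lintegral_indicator_one hs,
      lintegral_bern, lintegral_bern]
    congr 1
    · by_cases hx : (⟨true⟩ : ULift.{v} Bool) ∈ s
      · simp [hx, hr, ← ENNReal.ofReal_mul hq0.le, mul_div_cancel₀ p hq0.ne']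
      · simp [hx]
    · by_cases hx : (⟨false⟩ : ULift.{v} Bool) ∈ s
      · simp [hx, hr, ← ENNReal.ofReal_mul hq1.le, mul_div_cancel₀ (1 - p) hq1.ne']
      · simp [hx]
  have hac : bern.{v} p ≪ bern.{v} q := by
    rw [heq]
    exact withDensity_absolutelyContinuous _ _
  have hrn : (bern.{v} p).rnDeriv (bern.{v} q) =ᵐ[bern.{v} q] r := by
    rw [heq]
    exact Measure.rnDeriv_withDensity _ hrm
  unfold renyiDiv
  rw [if_pos hac, inv_mul_log_le_iff hα]
  refine le_trans (le_of_eq ?_) (ENNReal.ofReal_le_ofReal (h α hα))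
  rw [lintegral_congr_ae (hrn.mono fun x hx => by simp only [hx] :
    (fun x => (bern.{v} p).rnDeriv (bern.{v} q) x ^ α) =ᵐ[bern.{v} q] fun x => r x ^ α),
    lintegral_bern]
  have term : ∀ x y : ℝ, 0 < x → 0 < y → y * (x / y) ^ α = x ^ α * y ^ (1 - α) := by
    intro x y hx hy
    rw [Real.div_rpow hx.le hy.le, Real.rpow_sub hy, Real.rpow_one]
    field_simp
  simp only [hr, if_true, Bool.false_eq_true, if_false]
  rw [ENNReal.ofReal_rpow_of_pos (by positivity), ENNReal.ofReal_rpow_of_pos (by positivity),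
    ← ENNReal.ofReal_mul hq0.le, ← ENNReal.ofReal_mul hq1.le,
    ← ENNReal.ofReal_add (by positivity) (by positivity), term p q hp0 hq0,
    term (1 - p) (1 - q) hp1 hq1, bernMoment]

theorem bernImpliesDP_of_zCDPImpliesDP {B ε δ : ℝ} (hB0 : 0 ≤ B)
    (hB : ZCDPImpliesDP.{u, v} B ε δ) : BernImpliesDP B ε δ := by
  intro p hp q hq hpq hqp
  have hself : ∀ x ∈ Set.Ioo (0 : ℝ) 1, BernClose B x x := fun x hx α hα => by
    rw [bernMoment_self hx]
    exact Real.one_le_exp (mul_nonneg (mul_nonneg (by linarith) (by linarith)) hB0)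
  -- An algorithm that only reveals whether the dataset is empty. Neighbouring datasets may have
  -- equal laws, and closeness of a law to itself needs `0 ≤ B`.
  set c : List PUnit.{u + 1} → ℝ := fun S => if S = [] then q else p with hc
  have hcI : ∀ S, c S ∈ Set.Ioo (0 : ℝ) 1 := fun S => by
    by_cases hS : S = [] <;> simp only [hc, hS, if_true, if_false] <;> assumption
  have hclose : ∀ S S', BernClose B (c S) (c S') := fun S S' => by
    by_cases hS : S = [] <;> by_cases hS' : S' = [] <;>
      simp only [hc, hS, hS', if_true, if_false]
    exacts [hself q hq, hqp, hpq, hself p hp]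
  have : ∀ S, IsProbabilityMeasure (bern.{v} (c S)) := fun S => isProbabilityMeasure_bern (hcI S)
  have key := hB PUnit.{u + 1} (ULift.{v} Bool) (fun S => bern (c S))
    (fun S S' _ α hα => renyiDiv_bern_le (hcI S) (hcI S') (hclose S S') hα)
    [PUnit.unit] [] ⟨[PUnit.unit], ⟨0, by simp⟩, Or.inl rfl⟩ {⟨true⟩}
    (by
      have : ({⟨true⟩} : Set (ULift.{v} Bool)) = ULift.down ⁻¹' {true} := by
        ext ⟨b⟩
        simp
      rw [this]
      exact measurable_down (MeasurableSet.singleton true))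
  simpa [hc, bern_real_true hp, bern_real_true hq] using key

theorem zCDPImpliesDP_iff {B ε δ : ℝ} (hB0 : 0 ≤ B) (hε : 0 ≤ ε) (hδ : 0 ≤ δ) :
    ZCDPImpliesDP.{u, v} B ε δ ↔ BernImpliesDP B ε δ :=
  ⟨bernImpliesDP_of_zCDPImpliesDP hB0, zCDPImpliesDP_of_bernImpliesDP hε hδ⟩


/-! ### Pure differential privacy implies zCDP -/

theorem sinh_le_self_mul_cosh {x : ℝ} (hx : 0 ≤ x) : Real.sinh x ≤ x * Real.cosh x := by
  have hd : ∀ y : ℝ, HasDerivAt (fun y => y * Real.cosh y - Real.sinh y) (y * Real.sinh y) y := by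
    intro y
    have := ((hasDerivAt_id y).mul (Real.hasDerivAt_cosh y)).sub (Real.hasDerivAt_sinh y)
    refine this.congr_deriv ?_
    simp
  have hmono : MonotoneOn (fun y => y * Real.cosh y - Real.sinh y) (Set.Ici 0) := by
    refine monotoneOn_of_deriv_nonneg (convex_Ici 0)
      (fun y _ => (hd y).continuousAt.continuousWithinAt)
      (fun y _ => (hd y).differentiableAt.differentiableWithinAt) fun y hy => ?_
    rw [interior_Ici] at hy
    rw [(hd y).deriv]
    exact mul_nonneg (le_of_lt hy) (Real.sinh_nonneg_iff.2 (le_of_lt hy))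
  have := hmono (Set.mem_Ici.2 le_rfl) (Set.mem_Ici.2 hx) hx
  simp only [Real.sinh_zero, zero_mul, sub_zero] at this
  linarith

/-- `cosh y * exp (-y² / 2)` decreases on `y ≥ 0`, because `tanh y ≤ y`. -/
theorem cosh_le_cosh_mul_exp {u v : ℝ} (hv : 0 ≤ v) (hvu : v ≤ u) :
    Real.cosh u ≤ Real.cosh v * Real.exp ((u ^ 2 - v ^ 2) / 2) := by
  have hd : ∀ y : ℝ, HasDerivAt (fun y => Real.cosh y * Real.exp (-(y ^ 2 / 2)))
      ((Real.sinh y - y * Real.cosh y) * Real.exp (-(y ^ 2 / 2))) y := by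
    intro y
    have := (Real.hasDerivAt_cosh y).mul (((hasDerivAt_pow 2 y).div_const 2).neg.exp)
    refine this.congr_deriv ?_
    simp
    ring
  have hanti : AntitoneOn (fun y => Real.cosh y * Real.exp (-(y ^ 2 / 2))) (Set.Ici 0) := by
    refine antitoneOn_of_deriv_nonpos (convex_Ici 0)
      (fun y _ => (hd y).continuousAt.continuousWithinAt)
      (fun y _ => (hd y).differentiableAt.differentiableWithinAt) fun y hy => ?_
    rw [interior_Ici] at hy
    rw [(hd y).deriv]
    exact mul_nonpos_of_nonpos_of_nonneg (sub_nonpos.2 (sinh_le_self_mul_cosh (le_of_lt hy)))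
      (Real.exp_pos _).le
  have := hanti (Set.mem_Ici.2 hv) (Set.mem_Ici.2 (hv.trans hvu)) hvu
  have h2 := mul_le_mul_of_nonneg_right this (Real.exp_pos (u ^ 2 / 2)).le
  simp only [mul_assoc, ← Real.exp_add] at h2
  rw [neg_add_cancel, Real.exp_zero, mul_one] at h2
  refine h2.trans_eq ?_
  ring_nf

/-- The power function lies below its chord over `[exp (-ε), exp ε]`. -/
theorem rpow_add_le_chord {ε α t : ℝ} (hε : 0 < ε) (hα : 1 < α) (h₁ : Real.exp (-ε) ≤ t)
    (h₂ : t ≤ Real.exp ε) :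
    t ^ α + Real.sinh ((α - 1) * ε) / Real.sinh ε ≤ Real.sinh (α * ε) / Real.sinh ε * t := by
  have hs : 0 < Real.sinh ε := Real.sinh_pos_iff.2 hε
  set θ := (t - Real.exp (-ε)) / (2 * Real.sinh ε) with hθ
  have h2s : 2 * Real.sinh ε = Real.exp ε - Real.exp (-ε) := by rw [Real.sinh_eq]; ring
  have hθ0 : 0 ≤ θ := div_nonneg (by linarith) (by linarith)
  have hθ1 : θ ≤ 1 := by
    rw [hθ, div_le_one (by linarith), h2s]
    linarith
  have hconv := rpow_mix_le (Real.exp_pos (-ε)) (Real.exp_pos ε) hα.le hθ0 hθ1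
  have hθs : θ * (2 * Real.sinh ε) = t - Real.exp (-ε) := div_mul_cancel₀ _ (by linarith)
  have hmix : (1 - θ) * Real.exp (-ε) + θ * Real.exp ε = t := by
    rw [h2s] at hθs
    linarith
  rw [hmix, ← Real.exp_mul, ← Real.exp_mul] at hconv
  have e1 : Real.exp (-ε * α) = (Real.exp (α * ε))⁻¹ := by rw [← Real.exp_neg]; ring_nf
  have e2 : Real.exp (ε * α) = Real.exp (α * ε) := by ring_nf
  have e3 : Real.exp ((α - 1) * ε) = Real.exp (α * ε) * (Real.exp ε)⁻¹ := by
    rw [← Real.exp_neg, ← Real.exp_add]; ring_nf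
  have hx := Real.exp_pos (α * ε)
  have hy := Real.exp_pos ε
  rw [e1, e2] at hconv
  have : (1 - θ) * (Real.exp (α * ε))⁻¹ + θ * Real.exp (α * ε) + Real.sinh ((α - 1) * ε) /
      Real.sinh ε = Real.sinh (α * ε) / Real.sinh ε * t := by
    clear_value θ
    rw [← hmix, div_mul_eq_mul_div, eq_div_iff hs.ne', add_mul, div_mul_cancel₀ _ hs.ne']
    simp only [Real.sinh_eq, Real.exp_neg, e3]
    field_simp
    ring
  linarith

/-- The left side is `cosh ((α - 1/2) ε) / cosh (ε / 2)`, and `(α - 1/2)² - 1/4 = α (α - 1)`. -/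
theorem sinh_sub_sinh_div_le {ε α : ℝ} (hε : 0 < ε) (hα : 1 < α) :
    Real.sinh (α * ε) / Real.sinh ε - Real.sinh ((α - 1) * ε) / Real.sinh ε ≤
      Real.exp (α * (α - 1) * (ε ^ 2 / 2)) := by
  have hs : 0 < Real.sinh ε := Real.sinh_pos_iff.2 hε
  have hs2 : 0 < Real.sinh (ε / 2) := Real.sinh_pos_iff.2 (by linarith)
  have hc := cosh_le_cosh_mul_exp (u := (α - 1 / 2) * ε) (v := ε / 2) (by linarith) (by nlinarith)
  have e1 : Real.sinh (α * ε) - Real.sinh ((α - 1) * ε) =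
      2 * Real.cosh ((α - 1 / 2) * ε) * Real.sinh (ε / 2) := by
    have a1 : α * ε = (α - 1 / 2) * ε + ε / 2 := by ring
    have a2 : (α - 1) * ε = (α - 1 / 2) * ε - ε / 2 := by ring
    rw [a1, a2, Real.sinh_add, Real.sinh_sub]
    ring
  have e2 : Real.sinh ε = 2 * Real.sinh (ε / 2) * Real.cosh (ε / 2) := by
    rw [← Real.sinh_two_mul]; ring_nf
  have e3 : (((α - 1 / 2) * ε) ^ 2 - (ε / 2) ^ 2) / 2 = α * (α - 1) * (ε ^ 2 / 2) := by ring
  rw [e3] at hc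
  rw [← sub_div, div_le_iff₀ hs, e1, e2]
  nlinarith

/-- The density lies in `[exp (-ε), exp ε]` almost everywhere and has mean 1. Integrating the chord
of `t ^ α` over this interval bounds the moment by the difference of `sinh` quotients. -/
theorem lintegral_rnDeriv_rpow_le {Ω : Type*} [MeasurableSpace Ω] {μ ν : Measure Ω}
    [IsProbabilityMeasure μ] [IsProbabilityMeasure ν] {ε α : ℝ} (hε : 0 ≤ ε) (hα : 1 < α)
    (h₁ : ∀ E, MeasurableSet E → μ E ≤ ENNReal.ofReal (Real.exp ε) * ν E)
    (h₂ : ∀ E, MeasurableSet E → ν E ≤ ENNReal.ofReal (Real.exp ε) * μ E) :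
    ∫⁻ x, μ.rnDeriv ν x ^ α ∂ν ≤ ENNReal.ofReal (Real.exp (α * (α - 1) * (ε ^ 2 / 2))) := by
  have hac : μ ≪ ν := Measure.AbsolutelyContinuous.mk fun E hE h0 => by
    have := h₁ E hE
    rw [h0, mul_zero] at this
    exact le_antisymm this bot_le
  have hr := Measure.measurable_rnDeriv μ ν
  have hup : ∀ᵐ x ∂ν, μ.rnDeriv ν x ≤ ENNReal.ofReal (Real.exp ε) := by
    refine ae_le_of_forall_setLIntegral_le_of_sigmaFinite hr fun E hE _ => ?_
    rw [Measure.setLIntegral_rnDeriv hac, setLIntegral_const]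
    exact h₁ E hE
  have hlo : ∀ᵐ x ∂ν, 1 ≤ ENNReal.ofReal (Real.exp ε) * μ.rnDeriv ν x := by
    refine ae_le_of_forall_setLIntegral_le_of_sigmaFinite measurable_const fun E hE _ => ?_
    rw [lintegral_const_mul _ hr, Measure.setLIntegral_rnDeriv hac, setLIntegral_const, one_mul]
    exact h₂ E hE
  have hreal : ∀ᵐ x ∂ν, ∃ t : ℝ, μ.rnDeriv ν x = ENNReal.ofReal t ∧ Real.exp (-ε) ≤ t ∧
      t ≤ Real.exp ε := by
    filter_upwards [hup, hlo] with x hx hx'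
    have hne : μ.rnDeriv ν x ≠ ⊤ := ne_top_of_le_ne_top ENNReal.ofReal_ne_top hx
    refine ⟨_, (ENNReal.ofReal_toReal hne).symm, ?_, ?_⟩
    · rw [← ENNReal.ofReal_toReal hne, ← ENNReal.ofReal_mul (Real.exp_pos _).le,
        ← ENNReal.ofReal_one, ENNReal.ofReal_le_ofReal_iff (by positivity)] at hx'
      rw [Real.exp_neg, inv_le_iff_one_le_mul₀ (Real.exp_pos _), mul_comm]
      exact hx'
    · exact ENNReal.toReal_le_of_le_ofReal (Real.exp_pos _).le hx
  rcases hε.eq_or_lt with rfl | hε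
  · have : (fun x => μ.rnDeriv ν x ^ α) =ᵐ[ν] fun _ => 1 := by
      filter_upwards [hreal] with x ⟨t, ht, h1, h2⟩
      have : t = 1 := by simpa using le_antisymm h2 (by simpa using h1)
      rw [ht, this]
      simp
    rw [lintegral_congr_ae this]
    simp
  · have hs : 0 < Real.sinh ε := Real.sinh_pos_iff.2 hε
    set a := Real.sinh ((α - 1) * ε) / Real.sinh ε with ha
    set b := Real.sinh (α * ε) / Real.sinh ε with hb
    have ha0 : 0 ≤ a :=
      div_nonneg (Real.sinh_nonneg_iff.2 (mul_nonneg (by linarith) hε.le)) hs.le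
    have hb0 : 0 ≤ b :=
      div_nonneg (Real.sinh_nonneg_iff.2 (mul_nonneg (by linarith) hε.le)) hs.le
    have hint : ∫⁻ x, μ.rnDeriv ν x ^ α ∂ν + ENNReal.ofReal a ≤ ENNReal.ofReal b := by
      calc ∫⁻ x, μ.rnDeriv ν x ^ α ∂ν + ENNReal.ofReal a
          = ∫⁻ x, (μ.rnDeriv ν x ^ α + ENNReal.ofReal a) ∂ν := by
            rw [lintegral_add_right _ measurable_const]
            simp
        _ ≤ ∫⁻ x, ENNReal.ofReal b * μ.rnDeriv ν x ∂ν := by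
            refine lintegral_mono_ae ?_
            filter_upwards [hreal] with x ⟨t, ht, h1, h2⟩
            have ht0 : 0 < t := (Real.exp_pos _).trans_le h1
            rw [ht, ENNReal.ofReal_rpow_of_pos ht0, ← ENNReal.ofReal_add (by positivity) ha0,
              ← ENNReal.ofReal_mul hb0]
            exact ENNReal.ofReal_le_ofReal (rpow_add_le_chord hε hα h1 h2)
        _ = ENNReal.ofReal b := by
            rw [lintegral_const_mul _ hr, Measure.lintegral_rnDeriv hac, measure_univ, mul_one]
    calc ∫⁻ x, μ.rnDeriv ν x ^ α ∂ν ≤ ENNReal.ofReal b - ENNReal.ofReal a :=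
          ENNReal.le_sub_of_add_le_right ENNReal.ofReal_ne_top hint
      _ = ENNReal.ofReal (b - a) := (ENNReal.ofReal_sub _ ha0).symm
      _ ≤ _ := ENNReal.ofReal_le_ofReal (sinh_sub_sinh_div_le hε hα)


/-! ### Adaptive composition with a filter -/

section Composition

variable {𝒳 : Type u} {𝒴 : ℕ → Type v} [∀ t, MeasurableSpace (𝒴 t)]

theorem measure_le_of_logRatioSup_le {Ω : Type*} [MeasurableSpace Ω] {μ ν : Measure Ω}
    [IsFiniteMeasure ν] {ε : ℝ} (h : logRatioSup μ ν ≤ (ε : EReal)) {E : Set Ω}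
    (hE : MeasurableSet E) : μ E ≤ ENNReal.ofReal (Real.exp ε) * ν E := by
  have h1 : ENNReal.log (μ E / ν E) ≤ (ε : EReal) :=
    (le_iSup₂ (f := fun (E : Set Ω) (_ : MeasurableSet E) => ENNReal.log (μ E / ν E)) E hE).trans h
  have h2 : (ε : EReal) = ENNReal.log (ENNReal.ofReal (Real.exp ε)) := by
    rw [ENNReal.log_ofReal_of_pos (Real.exp_pos _), Real.log_exp]
  rw [h2, ENNReal.log_le_log_iff] at h1
  exact (ENNReal.div_le_iff_le_mul (Or.inr ENNReal.ofReal_ne_top)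
    (Or.inl (measure_ne_top _ _))).1 h1

theorem logRatioSup_le_epsParam {𝒮 : Set (List 𝒳 × List 𝒳)} {A : AlgSeq 𝒳 𝒴} {t : ℕ}
    {h : Hist 𝒴 t} (hfin : epsParam 𝒮 A t h ≠ ⊤) {S S' : List 𝒳} (hS : (S, S') ∈ 𝒮) :
    logRatioSup (A t S h) (A t S' h) ≤ (((epsParam 𝒮 A t h).toReal : ℝ) : EReal) := by
  have h1 : logRatioSup (A t S h) (A t S' h) ≤
      ⨆ p ∈ 𝒮, logRatioSup (A t p.1 h) (A t p.2 h) :=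
    le_iSup₂ (f := fun p (_ : p ∈ 𝒮) => logRatioSup (A t p.1 h) (A t p.2 h)) (S, S') hS
  refine h1.trans ?_
  rw [EReal.coe_ennreal_toReal hfin, epsParam, EReal.coe_toENNReal_eq_max]
  exact le_max_right _ _

theorem runFrom_succ_of_cont {G : List ℝ≥0∞ → Answer} {𝒮 : Set (List 𝒳 × List 𝒳)}
    {A : AlgSeq 𝒳 𝒴} {k : ℕ} {h : Hist 𝒴 k} (hG : G (epsList 𝒮 A k h) = Answer.CONT)
    (S : List 𝒳) (m : ℕ) : runFrom G 𝒮 A S (m + 1) k h =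
      (A k S h).bind fun a => runFrom G 𝒮 A S m (k + 1) (h.snoc a) := by
  rw [runFrom, hG]

theorem runFrom_succ_of_not_cont {G : List ℝ≥0∞ → Answer} {𝒮 : Set (List 𝒳 × List 𝒳)}
    {A : AlgSeq 𝒳 𝒴} {k : ℕ} {h : Hist 𝒴 k} (hG : G (epsList 𝒮 A k h) ≠ Answer.CONT)
    (S : List 𝒳) (m : ℕ) : runFrom G 𝒮 A S (m + 1) k h = Measure.dirac ⟨k, h⟩ := by
  have : G (epsList 𝒮 A k h) = Answer.HALT := by
    cases h' : G (epsList 𝒮 A k h)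
    · exact absurd h' hG
    · rfl
  rw [runFrom, this]

theorem measurable_transcript_mk (k : ℕ) :
    Measurable (fun h : Hist 𝒴 k => (⟨k, h⟩ : Transcript 𝒴)) :=
  measurable_iff_le_map.2 (iInf_le _ k)

theorem measurable_snoc (k : ℕ) :
    Measurable (fun p : Hist 𝒴 k × 𝒴 k => (p.1.snoc p.2 : Hist 𝒴 (k + 1))) :=
  measurable_id

/-- The sum of the squared parameters of the rounds `0, …, k - 1`. -/
def spent (𝒮 : Set (List 𝒳 × List 𝒳)) (A : AlgSeq 𝒳 𝒴) : (k : ℕ) → Hist 𝒴 k → ℝ≥0∞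
  | 0, _ => 0
  | k + 1, h => ((epsList 𝒮 A k h.1).map fun ε => ε ^ 2).sum

/-- After `k` reports the filter already sees the parameter of round `k`, so a round is charged
before it runs. -/
theorem sum_epsList (𝒮 : Set (List 𝒳 × List 𝒳)) (A : AlgSeq 𝒳 𝒴) (k : ℕ)
    (h : Hist 𝒴 k) :
    ((epsList 𝒮 A k h).map fun ε => ε ^ 2).sum = spent 𝒮 A k h + epsParam 𝒮 A k h ^ 2 := by
  cases k with
  | zero => simp [epsList, spent]
  | succ k => simp [epsList, spent]

/-! ### Runs as measurable families of probability measures, and their moments -/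

variable {G : List ℝ≥0∞ → Answer} {𝒮 : Set (List 𝒳 × List 𝒳)} {A : AlgSeq 𝒳 𝒴}
  [∀ t S, IsMarkovKernel (A t S)] {N : ℕ}

/-- Only the decision sets have to be measurable, not the parameters themselves; `k + m ≤ N` keeps
every decision within the range of `hG`. -/
theorem measurable_runFrom
    (hG : ∀ k < N, MeasurableSet {h : Hist 𝒴 k | G (epsList 𝒮 A k h) = Answer.CONT})
    (S : List 𝒳) : ∀ m k, k + m ≤ N → Measurable (runFrom G 𝒮 A S m k)
  | 0, k, _ => by
    have : runFrom G 𝒮 A S 0 k = fun h => Measure.dirac ⟨k, h⟩ := by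
      funext h
      rw [runFrom]
    rw [this]
    exact Measure.measurable_dirac.comp (measurable_transcript_mk k)
  | m + 1, k, hk => by
    classical
    have ih := measurable_runFrom hG S m (k + 1) (by omega)
    have : runFrom G 𝒮 A S (m + 1) k = fun h =>
        if h ∈ {h : Hist 𝒴 k | G (epsList 𝒮 A k h) = Answer.CONT} then
          (A k S h).bind fun a => runFrom G 𝒮 A S m (k + 1) (h.snoc a)
        else Measure.dirac ⟨k, h⟩ := by
      funext h
      split_ifs with hc
      · exact runFrom_succ_of_cont hc S m
      · exact runFrom_succ_of_not_cont hc S m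
    rw [this]
    refine Measurable.ite (hG k (by omega)) ?_
      (Measure.measurable_dirac.comp (measurable_transcript_mk k))
    refine Measure.measurable_of_measurable_coe _ fun E hE => ?_
    have hjoint : Measurable fun p : Hist 𝒴 k × 𝒴 k =>
        runFrom G 𝒮 A S m (k + 1) (p.1.snoc p.2) := ih.comp (measurable_snoc k)
    have hbind : ∀ h : Hist 𝒴 k,
        ((A k S h).bind fun a => runFrom G 𝒮 A S m (k + 1) (h.snoc a)) E =
        ∫⁻ a, runFrom G 𝒮 A S m (k + 1) (h.snoc a) E ∂(A k S h) := fun h =>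
      Measure.bind_apply hE (hjoint.comp measurable_prodMk_left).aemeasurable
    simp only [hbind]
    exact Measurable.lintegral_kernel_prod_right
      (f := fun (h : Hist 𝒴 k) (a : 𝒴 k) => runFrom G 𝒮 A S m (k + 1) (h.snoc a) E)
      ((Measure.measurable_coe hE).comp hjoint)

theorem measurable_runFrom_snoc
    (hG : ∀ k < N, MeasurableSet {h : Hist 𝒴 k | G (epsList 𝒮 A k h) = Answer.CONT})
    (S : List 𝒳) {m k : ℕ} (hk : k + (m + 1) ≤ N) (h : Hist 𝒴 k) :
    Measurable fun a => runFrom G 𝒮 A S m (k + 1) (h.snoc a) :=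
  (measurable_runFrom hG S m (k + 1) (by omega)).comp
    ((measurable_snoc k).comp measurable_prodMk_left)

theorem isProbabilityMeasure_runFrom
    (hG : ∀ k < N, MeasurableSet {h : Hist 𝒴 k | G (epsList 𝒮 A k h) = Answer.CONT})
    (S : List 𝒳) :
    ∀ m k, k + m ≤ N → ∀ h : Hist 𝒴 k, IsProbabilityMeasure (runFrom G 𝒮 A S m k h)
  | 0, k, _, h => by
    rw [runFrom]
    infer_instance
  | m + 1, k, hk, h => by
    by_cases hc : G (epsList 𝒮 A k h) = Answer.CONT
    · rw [runFrom_succ_of_cont hc]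
      have ih := isProbabilityMeasure_runFrom hG S m (k + 1) (by omega)
      refine ⟨?_⟩
      rw [Measure.bind_apply MeasurableSet.univ
        (measurable_runFrom_snoc hG S hk h).aemeasurable]
      have : ∀ a, runFrom G 𝒮 A S m (k + 1) (h.snoc a) Set.univ = 1 := fun a =>
        (ih (h.snoc a)).measure_univ
      simp [this]
    · rw [runFrom_succ_of_not_cont hc]
      infer_instance

/-- Induction on the number of rounds left, the exponent carrying the unspent budget. A halted run
has moment 1, which is within the bound because the budget is never overspent. -/
theorem eventMoment_runFrom_le {B : ℝ} (hB : 0 ≤ B) (hsym : IsSymmetric 𝒮)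
    (hG : ∀ k < N,
      MeasurableSet {h : Hist 𝒴 k | sumSqFilter B (epsList 𝒮 A k h) = Answer.CONT})
    {S S' : List 𝒳} (hS : (S, S') ∈ 𝒮) {E : Set (Transcript 𝒴)} (hE : MeasurableSet E)
    {α : ℝ} (hα : 1 < α) :
    ∀ m k, k + m ≤ N → ∀ h : Hist 𝒴 k, spent 𝒮 A k h ≤ ENNReal.ofReal (2 * B) →
      eventMoment α (runFrom (sumSqFilter B) 𝒮 A S m k h)
        (runFrom (sumSqFilter B) 𝒮 A S' m k h) E ≤
      ENNReal.ofReal (Real.exp (α * (α - 1) * (B - (spent 𝒮 A k h).toReal / 2))) := by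
  have hαα : 0 ≤ α * (α - 1) := mul_nonneg (by linarith) (by linarith)
  have h_dirac : ∀ (k : ℕ) (h : Hist 𝒴 k), spent 𝒮 A k h ≤ ENNReal.ofReal (2 * B) →
      eventMoment α (Measure.dirac (⟨k, h⟩ : Transcript 𝒴)) (Measure.dirac ⟨k, h⟩) E ≤
      ENNReal.ofReal (Real.exp (α * (α - 1) * (B - (spent 𝒮 A k h).toReal / 2))) := by
    intro k h hs
    rw [eventMoment_dirac _ hE hα, ← ENNReal.ofReal_one]
    refine ENNReal.ofReal_le_ofReal (Real.one_le_exp (mul_nonneg hαα ?_))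
    have := ENNReal.toReal_le_of_le_ofReal (by linarith) hs
    linarith
  intro m
  induction m with
  | zero =>
    intro k _ h hs
    rw [runFrom, runFrom]
    exact h_dirac k h hs
  | succ m ih =>
    intro k hk h hs
    by_cases hc : sumSqFilter B (epsList 𝒮 A k h) = Answer.CONT
    swap
    · rw [runFrom_succ_of_not_cont hc, runFrom_succ_of_not_cont hc]
      exact h_dirac k h hs
    have hsum : ((epsList 𝒮 A k h).map fun ε => ε ^ 2).sum ≤ ENNReal.ofReal (2 * B) := by
      unfold sumSqFilter at hc
      split_ifs at hc with hle
      rw [ENNReal.div_le_iff_le_mul (Or.inl two_ne_zero) (Or.inl ENNReal.ofNat_ne_top)] at hle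
      rwa [mul_comm, ENNReal.ofReal_mul hB, ENNReal.ofReal_ofNat]
    have hsumt : ((epsList 𝒮 A k h).map fun ε => ε ^ 2).sum ≠ ⊤ :=
      ne_top_of_le_ne_top ENNReal.ofReal_ne_top hsum
    have hst : spent 𝒮 A k h ≠ ⊤ := ne_top_of_le_ne_top ENNReal.ofReal_ne_top hs
    -- A round with infinite parameter would have made the filter halt.
    have hεt : epsParam 𝒮 A k h ≠ ⊤ := by
      intro ht
      rw [sum_epsList, ht] at hsumt
      simp at hsumt
    have hdecomp : (((epsList 𝒮 A k h).map fun ε => ε ^ 2).sum).toReal =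
        (spent 𝒮 A k h).toReal + (epsParam 𝒮 A k h).toReal ^ 2 := by
      rw [sum_epsList, ENNReal.toReal_add hst (ENNReal.pow_ne_top hεt), ENNReal.toReal_pow]
    have hpure := lintegral_rnDeriv_rpow_le (μ := A k S h) (ν := A k S' h)
      ENNReal.toReal_nonneg hα
      (fun E hE => measure_le_of_logRatioSup_le (logRatioSup_le_epsParam hεt hS) hE)
      (fun E hE => measure_le_of_logRatioSup_le
        (logRatioSup_le_epsParam hεt (hsym S S' hS)) hE)
    have hac : A k S h ≪ A k S' h := Measure.AbsolutelyContinuous.mk fun E hE h0 => by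
      have := measure_le_of_logRatioSup_le (logRatioSup_le_epsParam hεt hS) hE
      rw [h0, mul_zero] at this
      exact le_antisymm this bot_le
    have (a : 𝒴 k) :
        IsProbabilityMeasure (runFrom (sumSqFilter B) 𝒮 A S' m (k + 1) (h.snoc a)) :=
      isProbabilityMeasure_runFrom hG S' m (k + 1) (by omega) (h.snoc a)
    rw [runFrom_succ_of_cont hc, runFrom_succ_of_cont hc]
    -- The budget left after this round depends on `h` but not on the new report `a`, so the
    -- induction hypothesis is uniform in `a`, as data processing requires.
    refine (eventMoment_bind_le hac (measurable_runFrom_snoc hG S hk h)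
      (measurable_runFrom_snoc hG S' hk h) hE hα (c := ENNReal.ofReal (Real.exp
        (α * (α - 1) * (B - (((epsList 𝒮 A k h).map fun ε => ε ^ 2).sum).toReal / 2))))
      (fun a => ih (k + 1) (by omega) (h.snoc a) hsum)).trans ?_
    refine (mul_le_mul_right hpure _).trans_eq ?_
    rw [← ENNReal.ofReal_mul (Real.exp_pos _).le, ← Real.exp_add, hdecomp]
    ring_nf

end Composition

theorem isDPFilter_sumSqFilter {B ε δ : ℝ} (hB0 : 0 ≤ B) (hε : 0 ≤ ε) (hδ : 0 ≤ δ)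
    (hB : BernImpliesDP B ε δ) : IsDPFilter.{u, v} ε δ (sumSqFilter B) := by
  intro 𝒳 𝒮 hsym 𝒴 _ A _ N hG S S' hS E hE
  have hprob : ∀ T, IsProbabilityMeasure (filteredComposition (sumSqFilter B) 𝒮 A N T) :=
    fun T => isProbabilityMeasure_runFrom hG T N 0 (by omega) PUnit.unit
  have key : ∀ {T T' : List 𝒳}, (T, T') ∈ 𝒮 → ∀ α : ℝ, 1 < α →
      eventMoment α (filteredComposition (sumSqFilter B) 𝒮 A N T)
        (filteredComposition (sumSqFilter B) 𝒮 A N T') E ≤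
      ENNReal.ofReal (Real.exp (α * (α - 1) * B)) := by
    intro T T' hT α hα
    simpa [spent, filteredComposition] using eventMoment_runFrom_le hB0 hsym hG hT hE hα N 0 (by omega) PUnit.unit
      (by simp [spent])
  exact real_le_of_eventMoment_le hε hδ hB hE (key hS) (key (hsym S S' hS))

end DPFilter

end

theorem theorem4p3 (εg δg : ℝ) (hε : 0 ≤ εg) (hδ0 : 0 < δg) (hδ1 : δg < 1) :
    (∃ Bstar : ℝ,
      IsGreatest {B : ℝ | 0 < B ∧ DPFilter.ZCDPImpliesDP.{u, v} B εg δg} Bstar ∧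
      DPFilter.IsDPFilter.{u, v} εg δg (DPFilter.sumSqFilter Bstar)) ∧
    DPFilter.ZCDPImpliesDP.{u, v}
      ((-Real.sqrt (Real.log (1 / δg)) + Real.sqrt (Real.log (1 / δg) + εg)) ^ 2) εg δg ∧
    DPFilter.IsDPFilter.{u, v} εg δg
      (DPFilter.sumSqFilter
        ((-Real.sqrt (Real.log (1 / δg)) + Real.sqrt (Real.log (1 / δg) + εg)) ^ 2)) := by
  have hexp := DPFilter.bernImpliesDP_explicit hε hδ0 hδ1
  refine ⟨?_, DPFilter.zCDPImpliesDP_of_bernImpliesDP hε hδ0.le hexp,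
    DPFilter.isDPFilter_sumSqFilter (sq_nonneg _) hε hδ0.le hexp⟩
  obtain ⟨B, ⟨hB0, hB⟩, hmax⟩ := DPFilter.exists_isGreatest_bernImpliesDP hε hδ0 hδ1
  refine ⟨B, ⟨⟨hB0, (DPFilter.zCDPImpliesDP_iff hB0.le hε hδ0.le).2 hB⟩, fun B' hB' => ?_⟩,
    DPFilter.isDPFilter_sumSqFilter hB0.le hε hδ0.le hB⟩
  -- Maximality transfers because every competing zCDP level is also admissible for Bernoulli laws.
  exact hmax ⟨hB'.1, (DPFilter.zCDPImpliesDP_iff hB'.1.le hε hδ0.le).1 hB'.2⟩
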